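/- Let $\mathcal K$ be a finite-dimensional complex inner product space of dimension $d$. For a self-adjoint operator $S$ on $\mathcal K$ let $\lambda(S)\in\mathbb R^d$ be the vector of its eigenvalues, with multiplicity, in non-increasing order. For self-adjoint $B, C$ write $B\succeq C$ ($B$ majorizes $C$) if $\sum_{i=1}^k\lambda_i(B)\ge\sum_{i=1}^k\lambda_i(C)$ for $1\le k\le d-1$ and $\sum_{i=1}^d\lambda_i(B)=\sum_{i=1}^d\lambda_i(C)$. A tuple $(T_1,\dots,T_\ell)$ of self-adjoint operators is more aligned than $(R_1,\dots,R_\ell)$ if $\lambda(T_i)=\lambda(R_i)$ for all $i$ and $\sum_i p_iT_i\succeq\sum_i p_iR_i$ for every probability vector $(p_1,\dots,p_\ell)$. A projector is a self-adjoint idempotent operator, and $|R|=\sqrt{R^*R}$. Let $r_1,r_2\in\{0,1,\dots,d\}$ and let $c$ be a real number with $0\le c\le\min(r_1,r_2)$ and $r_1+r_2-d\le\lfloor c\rfloor$. Let $G_{r_1,r_2,c}$ be the set of pairs $(P_1,P_2)$ of projectors on $\mathcal K$ with $\operatorname{rank}P_1=r_1$, $\operatorname{rank}P_2=r_2$ and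 $\operatorname{tr}|P_1P_2|\le c$. Theorem. There is a pair $(P_1^{\mathrm{opt}},P_2^{\mathrm{opt}})\in G_{r_1,r_2,c}$ that is maximal in the alignment ordering on $G_{r_1,r_2,c}$, in the sense that it is more aligned than every $(P_1,P_2)\in G_{r_1,r_2,c}$; moreover $$s_1P_1^{\mathrm{opt}}+s_2P_2^{\mathrm{opt}}\succeq s_1P_1+s_2P_2\qquad\text{for all } s_1,s_2\ge 0 \text{ and all } (P_1,P_2)\in G_{r_1,r_2,c}.$$ This pair satisfies $\operatorname{tr}|P_1^{\mathrm{opt}}P_2^{\mathrm{opt}}|=c$, and if $c$ is an integer, then $P_1^{\mathrm{opt}}P_2^{\mathrm{opt}}=P_2^{\mathrm{opt}}P_1^{\mathrm{opt}}$. -/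

import Mathlib

/-!
Operators on a finite-dimensional complex inner product space `K`. The instance
`[CompleteSpace K]` is automatic in finite dimension; it is listed only because the
C⋆-algebra structure on `K →L[ℂ] K` is indexed by it.
-/

namespace SpinAlignment

/-- `x↓`: the entries of `x` rearranged in non-increasing order. -/
noncomputable def decreasing {d : ℕ} (x : Fin d → ℝ) : Fin d → ℝ :=
  fun i => x (Tuple.sort x (Fin.rev i))

theorem antitone_decreasing {d : ℕ} (x : Fin d → ℝ) : Antitone (decreasing x) :=
  fun _ _ h => Tuple.monotone_sort x (Fin.rev_le_rev.mpr h)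

/-- Majorization of real vectors, `x ⪰ y`. -/
def VecMajorizes {d : ℕ} (x y : Fin d → ℝ) : Prop :=
  (∀ k : ℕ, k < d →
    ∑ i : Fin d with i.val < k, decreasing y i ≤ ∑ i : Fin d with i.val < k, decreasing x i) ∧
  ∑ i, decreasing x i = ∑ i, decreasing y i

section Operators

variable {K : Type*} [NormedAddCommGroup K] [InnerProductSpace ℂ K] [FiniteDimensional ℂ K]
  [CompleteSpace K]

/-- `λ(S)`: the eigenvalues of a self-adjoint operator, with multiplicity, in non-increasing
order. -/
noncomputable def eigenvalueVector (S : selfAdjoint (K →L[ℂ] K)) :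
    Fin (Module.finrank ℂ K) → ℝ :=
  (ContinuousLinearMap.isSelfAdjoint_iff_isSymmetric.mp S.2).eigenvalues rfl

/-- Majorization of self-adjoint operators, `B ⪰ C`. -/
def Majorizes (B C : selfAdjoint (K →L[ℂ] K)) : Prop :=
  VecMajorizes (eigenvalueVector B) (eigenvalueVector C)

/-- The tuple `T` is more aligned than the tuple `R`: the tuples have matching spectra and every
convex combination of the entries of `T` majorizes the same combination of the entries of `R`. -/
def MoreAligned {l : ℕ} (T R : Fin l → selfAdjoint (K →L[ℂ] K)) : Prop :=
  (∀ i, eigenvalueVector (T i) = eigenvalueVector (R i)) ∧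
  ∀ p : Fin l → ℝ, (∀ i, 0 ≤ p i) → ∑ i, p i = 1 →
    Majorizes (∑ i, p i • T i) (∑ i, p i • R i)

/-- `tr |R|`, where `|R| = √(R⋆ R)`; the trace is real because `|R|` is positive. -/
noncomputable def traceAbs (R : K →L[ℂ] K) : ℝ :=
  (LinearMap.trace ℂ K (CFC.abs R : K →L[ℂ] K)).re

/-- The rank of an operator, as a natural number. -/
noncomputable def rank (R : K →L[ℂ] K) : ℕ :=
  Module.finrank ℂ (LinearMap.range (R : K →ₗ[ℂ] K))

variable (K) in
/-- `G_{r₁,r₂,c}`: the pairs of projectors (self-adjoint idempotents) of ranks `r₁`, `r₂` with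
`tr |P₁ P₂| ≤ c`. -/
def projectorPairs (r₁ r₂ : ℕ) (c : ℝ) :
    Set (selfAdjoint (K →L[ℂ] K) × selfAdjoint (K →L[ℂ] K)) :=
  {P | IsStarProjection (P.1 : K →L[ℂ] K) ∧ IsStarProjection (P.2 : K →L[ℂ] K) ∧
    rank (P.1 : K →L[ℂ] K) = r₁ ∧ rank (P.2 : K →L[ℂ] K) = r₂ ∧
    traceAbs ((P.1 : K →L[ℂ] K) * (P.2 : K →L[ℂ] K)) ≤ c}

end Operators

end SpinAlignment

namespace SpinAlignment

open Set

/-! For fixed ranks and weights, the spectrum of `s₁P₁ + s₂P₂` depends only on the singular values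
`σᵢ` of `P₁P₂`. A determinant identity (`smul_one_sub_mul_smul_one_sub`) shows that the sum of `φ`
over the spectrum is a constant plus the sum of `φ(upperEigenvalue σᵢ) + φ(lowerEigenvalue σᵢ)`
(`sum_eigenvalueVector_smul_add_smul`). For convex `φ` this summand is convex in `σᵢ` and increasing
on `σᵢ ≥ 0`.

The `σᵢ` lie in `[0, 1]` and have sum at most `c`, so all these sums are maximized at once by the
greedy vector `(1, …, 1, c - ⌊c⌋, 0, …, 0)` (`sum_le_sum_unitClamp`). Majorization follows from
equal traces and the functions `max (u - t) 0` (`vecMajorizes_of_sum_max`). It remains to exhibit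
projectors whose product has the greedy singular values (`exists_greedy_projections`). -/

theorem _root_.ConvexOn.add_le_add_of_mem_Icc {g : ℝ → ℝ} (hg : ConvexOn ℝ univ g)
    {a b p q : ℝ} (hpa : p ≤ a) (haq : a ≤ q) (h : p + q = a + b) : g a + g b ≤ g p + g q := by
  rcases (hpa.trans haq).eq_or_lt with hpq | hpq
  · have h₁ : a = p := by linarith
    have h₂ : b = q := by linarith
    rw [h₁, h₂]
  · have hq : 0 < q - p := sub_pos.mpr hpq
    set t := (a - p) / (q - p)
    have htq : t * (q - p) = a - p := div_mul_cancel₀ _ hq.ne'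
    have ht₀ : 0 ≤ t := div_nonneg (by linarith) hq.le
    have ht₁ : t ≤ 1 := (div_le_one hq).mpr (by linarith)
    have h₁ := hg.2 (mem_univ p) (mem_univ q) (sub_nonneg.mpr ht₁) ht₀ (by ring)
    have h₂ := hg.2 (mem_univ p) (mem_univ q) ht₀ (sub_nonneg.mpr ht₁) (by ring)
    simp only [smul_eq_mul] at h₁ h₂
    rw [show (1 - t) * p + t * q = a by linarith] at h₁
    rw [show t * p + (1 - t) * q = b by linarith] at h₂
    linarith

/-- The point of the unit interval closest to `x`. -/
noncomputable def unitClamp (x : ℝ) : ℝ := max 0 (min x 1)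

theorem unitClamp_nonneg (x : ℝ) : 0 ≤ unitClamp x := le_max_left _ _

theorem unitClamp_le_one (x : ℝ) : unitClamp x ≤ 1 := max_le zero_le_one (min_le_right _ _)

theorem unitClamp_mono : Monotone unitClamp :=
  fun _ _ h => max_le_max le_rfl (min_le_min h le_rfl)

theorem unitClamp_of_nonpos {x : ℝ} (h : x ≤ 0) : unitClamp x = 0 :=
  max_eq_left ((min_le_left _ _).trans h)

theorem unitClamp_of_one_le {x : ℝ} (h : 1 ≤ x) : unitClamp x = 1 := by
  rw [unitClamp, min_eq_right h, max_eq_right zero_le_one]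

theorem unitClamp_of_mem {x : ℝ} (h₀ : 0 ≤ x) (h₁ : x ≤ 1) : unitClamp x = x := by
  rw [unitClamp, min_eq_left h₁, max_eq_right h₀]

/-! ### Convex symmetric sums over the unit cube with bounded total -/

section Convex

variable {g : ℝ → ℝ} (hg : ConvexOn ℝ univ g) (hmono : MonotoneOn g (Ici 0))

include hg in
theorem add_le_unitClamp_add {a b : ℝ} (ha₀ : 0 ≤ a) (ha₁ : a ≤ 1) (hb₀ : 0 ≤ b) (hb₁ : b ≤ 1) :
    g a + g b ≤ g (unitClamp (a + b)) + g (unitClamp (a + b - 1)) := by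
  rcases le_total (a + b) 1 with h | h
  · rw [unitClamp_of_mem (by linarith) h, unitClamp_of_nonpos (by linarith), add_comm (g (a + b))]
    exact hg.add_le_add_of_mem_Icc ha₀ (by linarith) (by ring)
  · rw [unitClamp_of_one_le h, unitClamp_of_mem (by linarith) (by linarith), add_comm (g 1)]
    exact hg.add_le_add_of_mem_Icc (by linarith) ha₁ (by ring)

include hg hmono in
-- A greedy vector absorbs one more entry `b`. If `S ≥ 1`, both sides share a leading `1` and the
-- induction continues at `S - 1`. If `S ≤ 1`, all but two entries vanish and `add_le_unitClamp_add`
-- applies.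
theorem sum_unitClamp_add_le {b : ℝ} (hb₀ : 0 ≤ b) (hb₁ : b ≤ 1) (m : ℕ) {S : ℝ} (hS : 0 ≤ S) :
    ∑ i ∈ Finset.range m, g (unitClamp (S - i)) + g b ≤
      ∑ i ∈ Finset.range (m + 1), g (unitClamp (S + b - i)) := by
  induction m generalizing S with
  | zero =>
    simp only [Finset.range_zero, Finset.sum_empty, zero_add, Finset.range_one,
      Finset.sum_singleton, Nat.cast_zero, sub_zero]
    -- Monotonicity is needed because `S` may exceed the number of slots, so the totals need not
    -- agree.
    refine hmono hb₀ (unitClamp_nonneg _) ?_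
    rw [← unitClamp_of_mem hb₀ hb₁]
    exact unitClamp_mono (by rw [unitClamp_of_mem hb₀ hb₁]; linarith)
  | succ m ih =>
    have hshift : ∀ (k : ℕ) (T : ℝ), ∑ i ∈ Finset.range (k + 1), g (unitClamp (T - i)) =
        ∑ i ∈ Finset.range k, g (unitClamp (T - 1 - i)) + g (unitClamp T) := by
      intro k T
      rw [Finset.sum_range_succ']
      simp only [Nat.cast_add, Nat.cast_one, Nat.cast_zero, sub_zero]
      congr 1
      refine Finset.sum_congr rfl fun i _ => ?_
      rw [show T - (i + 1) = T - 1 - i by ring]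
    rcases le_total 1 S with h | h
    · rw [hshift m S, hshift (m + 1) (S + b), unitClamp_of_one_le h,
        unitClamp_of_one_le (by linarith), show S + b - 1 = S - 1 + b by ring]
      linarith [ih (S := S - 1) (by linarith)]
    · rw [hshift m S, hshift (m + 1) (S + b), hshift m (S + b - 1), unitClamp_of_mem hS h]
      have hz : ∀ T : ℝ, T ≤ 0 → ∑ i ∈ Finset.range m, g (unitClamp (T - i)) = m * g 0 := by
        intro T hT
        rw [Finset.sum_congr rfl fun i _ => by
          rw [unitClamp_of_nonpos (by linarith [(Nat.cast_nonneg i : (0 : ℝ) ≤ i)])]]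
        simp
      rw [hz _ (by linarith), hz _ (by linarith)]
      linarith [add_le_unitClamp_add hg hS h hb₀ hb₁]

include hg hmono in
/-- Among the vectors in the unit cube whose entries sum to at most `c`, a symmetric sum of a
convex monotone function is largest at the greedy vector `(1, …, 1, c - ⌊c⌋, 0, …, 0)`. -/
theorem sum_le_sum_unitClamp {m : ℕ} {x : Fin m → ℝ} (hx₀ : ∀ i, 0 ≤ x i) (hx₁ : ∀ i, x i ≤ 1)
    {c : ℝ} (hc : ∑ i, x i ≤ c) :
    ∑ i, g (x i) ≤ ∑ i : Fin m, g (unitClamp (c - i)) := by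
  have key : ∑ i, g (x i) ≤ ∑ i ∈ Finset.range m, g (unitClamp (∑ i, x i - i)) := by
    clear hc
    induction m with
    | zero => simp
    | succ m ih =>
      rw [Fin.sum_univ_castSucc, Fin.sum_univ_castSucc]
      have h₁ := ih (x := fun i => x i.castSucc) (fun i => hx₀ _) (fun i => hx₁ _)
      have h₂ := sum_unitClamp_add_le hg hmono (hx₀ (Fin.last m)) (hx₁ (Fin.last m)) m
        (S := ∑ i : Fin m, x i.castSucc) (Finset.sum_nonneg fun i _ => hx₀ _)
      linarith
  refine key.trans ?_
  rw [Finset.sum_range]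
  exact Finset.sum_le_sum fun i _ => hmono (unitClamp_nonneg _) (unitClamp_nonneg _)
    (unitClamp_mono (by linarith))

end Convex

theorem sum_unitClamp {c : ℝ} (hc₀ : 0 ≤ c) {m : ℕ} (hc : c ≤ m) :
    ∑ i : Fin m, unitClamp (c - i) = c := by
  rw [← Finset.sum_range (fun i => unitClamp (c - i))]
  induction m generalizing c with
  | zero => simp at hc ⊢; linarith
  | succ m ih =>
    rw [Finset.sum_range_succ']
    simp only [Nat.cast_add, Nat.cast_one, Nat.cast_zero, sub_zero] at hc ⊢
    rcases le_total 1 c with h | h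
    · have := ih (c := c - 1) (by linarith) (by linarith)
      rw [unitClamp_of_one_le h]
      simp only [sub_sub, add_comm (1 : ℝ)] at this
      linarith
    · rw [unitClamp_of_mem hc₀ h, Finset.sum_eq_zero, zero_add]
      intro i _
      exact unitClamp_of_nonpos (by linarith [(Nat.cast_nonneg i : (0 : ℝ) ≤ i)])

/-! ### Majorization through the functions `max (u - t) 0` -/

theorem sum_decreasing {d : ℕ} (x : Fin d → ℝ) (φ : ℝ → ℝ) :
    ∑ i, φ (decreasing x i) = ∑ i, φ (x i) :=
  (Fin.revPerm.trans (Tuple.sort x)).sum_comp fun i => φ (x i)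

theorem vecMajorizes_of_sum_max {d : ℕ} {x y : Fin d → ℝ} (h : ∑ i, x i = ∑ i, y i)
    (hmax : ∀ t : ℝ, ∑ i, max (y i - t) 0 ≤ ∑ i, max (x i - t) 0) : VecMajorizes x y := by
  refine ⟨fun k hk => ?_, ?_⟩
  · rcases k.eq_zero_or_pos with rfl | hk₀
    · simp
    -- With `t` the `k`-th largest entry of `x`, the truncated sum is exactly the sum of the top `k`
    -- differences for `x`, and at least that sum for `y`.
    set t := decreasing x ⟨k - 1, by omega⟩
    have hall : ∑ i, max (decreasing y i - t) 0 ≤ ∑ i, max (decreasing x i - t) 0 := by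
      rw [sum_decreasing y fun u => max (u - t) 0, sum_decreasing x fun u => max (u - t) 0]
      exact hmax t
    have h₁ : ∑ i : Fin d with i.val < k, (decreasing y i - t) ≤
        ∑ i, max (decreasing y i - t) 0 :=
      (Finset.sum_le_sum fun i _ => le_max_left _ 0).trans <|
        Finset.sum_le_sum_of_subset_of_nonneg (Finset.subset_univ _) fun i _ _ => le_max_right _ _
    have h₂ : ∑ i, max (decreasing x i - t) 0 =
        ∑ i : Fin d with i.val < k, (decreasing x i - t) := by
      rw [Finset.sum_filter]
      refine Finset.sum_congr rfl fun i _ => ?_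
      split_ifs with hi
      · refine max_eq_left (sub_nonneg.mpr (antitone_decreasing x ?_))
        rw [Fin.le_def]
        simp only
        omega
      · refine max_eq_right (sub_nonpos.mpr (antitone_decreasing x ?_))
        rw [Fin.le_def]
        simp only
        omega
    rw [Finset.sum_sub_distrib] at h₁ h₂
    linarith
  · rw [sum_decreasing x fun u => u, sum_decreasing y fun u => u, h]

/-! ### Eigenvalues of a weighted sum of two lines -/

/-- The larger eigenvalue of `s₁ P₁ + s₂ P₂` when `P₁`, `P₂` are lines at angle `arccos x`. -/
noncomputable def upperEigenvalue (s₁ s₂ x : ℝ) : ℝ :=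
  (s₁ + s₂ + √((s₁ - s₂) ^ 2 + 4 * s₁ * s₂ * x ^ 2)) / 2

/-- The smaller eigenvalue of `s₁ P₁ + s₂ P₂` when `P₁`, `P₂` are lines at angle `arccos x`. -/
noncomputable def lowerEigenvalue (s₁ s₂ x : ℝ) : ℝ :=
  (s₁ + s₂ - √((s₁ - s₂) ^ 2 + 4 * s₁ * s₂ * x ^ 2)) / 2

theorem upperEigenvalue_add_lowerEigenvalue (s₁ s₂ x : ℝ) :
    upperEigenvalue s₁ s₂ x + lowerEigenvalue s₁ s₂ x = s₁ + s₂ := by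
  unfold upperEigenvalue lowerEigenvalue
  ring

theorem sub_upperEigenvalue_mul_sub_lowerEigenvalue {s₁ s₂ : ℝ} (h₁ : 0 ≤ s₁) (h₂ : 0 ≤ s₂)
    (x z : ℝ) :
    (z - upperEigenvalue s₁ s₂ x) * (z - lowerEigenvalue s₁ s₂ x) =
      (z - s₁) * (z - s₂) - s₁ * s₂ * x ^ 2 := by
  have h : √((s₁ - s₂) ^ 2 + 4 * s₁ * s₂ * x ^ 2) ^ 2 = (s₁ - s₂) ^ 2 + 4 * s₁ * s₂ * x ^ 2 :=
    Real.sq_sqrt (by positivity)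
  unfold upperEigenvalue lowerEigenvalue
  linear_combination (-1 / 4) * h

/-- The function is the norm of `a + i√b x`, which is affine in `x`. -/
theorem convexOn_sqrt_add_sq (a : ℝ) {b : ℝ} (hb : 0 ≤ b) :
    ConvexOn ℝ univ fun x : ℝ => √(a ^ 2 + b * x ^ 2) := by
  have h : (fun x : ℝ => √(a ^ 2 + b * x ^ 2)) =
      fun x : ℝ => ‖(⟨a, √b * x⟩ : ℂ)‖ := by
    funext x
    rw [Complex.norm_def, Complex.normSq_mk]
    congr 1
    rw [mul_mul_mul_comm, Real.mul_self_sqrt hb]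
    ring
  rw [h]
  refine ⟨convex_univ, fun x _ y _ u v hu hv huv => ?_⟩
  have e : (⟨a, √b * (u • x + v • y)⟩ : ℂ) = u • ⟨a, √b * x⟩ + v • ⟨a, √b * y⟩ := by
    apply Complex.ext
    · simp only [Complex.add_re, Complex.smul_re, smul_eq_mul]
      rw [← add_mul, huv, one_mul]
    · simp only [Complex.add_im, Complex.smul_im, smul_eq_mul]
      ring
  simp only [e]
  refine (norm_add_le _ _).trans ?_
  rw [norm_smul, norm_smul, Real.norm_of_nonneg hu, Real.norm_of_nonneg hv]
  rfl

theorem _root_.ConvexOn.symm_pair_mono {φ : ℝ → ℝ} (hφ : ConvexOn ℝ univ φ) (m : ℝ) {y z : ℝ}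
    (hy : 0 ≤ y) (hyz : y ≤ z) :
    φ ((m + y) / 2) + φ ((m - y) / 2) ≤ φ ((m + z) / 2) + φ ((m - z) / 2) := by
  rw [add_comm (φ ((m + z) / 2))]
  exact hφ.add_le_add_of_mem_Icc (by linarith) (by linarith) (by ring)

/-- The gap between the two eigenvalues is convex in `x`, and the symmetric pair sum of `φ` is
convex and increasing in the gap. -/
theorem convexOn_pair_eigenvalues {φ : ℝ → ℝ} (hφ : ConvexOn ℝ univ φ) {s₁ s₂ : ℝ}
    (h₁ : 0 ≤ s₁) (h₂ : 0 ≤ s₂) :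
    ConvexOn ℝ univ fun x => φ (upperEigenvalue s₁ s₂ x) + φ (lowerEigenvalue s₁ s₂ x) := by
  have hf := convexOn_sqrt_add_sq (s₁ - s₂) (b := 4 * s₁ * s₂) (by positivity)
  refine ⟨convex_univ, fun x hx y hy u v hu hv huv => ?_⟩
  have hle := hf.2 hx hy hu hv huv
  simp only [upperEigenvalue, lowerEigenvalue]
  refine (hφ.symm_pair_mono (s₁ + s₂) (Real.sqrt_nonneg _) hle).trans ?_
  set p := √((s₁ - s₂) ^ 2 + 4 * s₁ * s₂ * x ^ 2)
  set q := √((s₁ - s₂) ^ 2 + 4 * s₁ * s₂ * y ^ 2)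
  have i₁ := hφ.2 (mem_univ ((s₁ + s₂ + p) / 2)) (mem_univ ((s₁ + s₂ + q) / 2)) hu hv huv
  have i₂ := hφ.2 (mem_univ ((s₁ + s₂ - p) / 2)) (mem_univ ((s₁ + s₂ - q) / 2)) hu hv huv
  simp only [smul_eq_mul] at i₁ i₂ ⊢
  have e₁ : u * ((s₁ + s₂ + p) / 2) + v * ((s₁ + s₂ + q) / 2) =
      (s₁ + s₂ + (u * p + v * q)) / 2 := by linear_combination ((s₁ + s₂) / 2) * huv
  have e₂ : u * ((s₁ + s₂ - p) / 2) + v * ((s₁ + s₂ - q) / 2) =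
      (s₁ + s₂ - (u * p + v * q)) / 2 := by linear_combination ((s₁ + s₂) / 2) * huv
  rw [e₁] at i₁
  rw [e₂] at i₂
  linarith

theorem monotoneOn_pair_eigenvalues {φ : ℝ → ℝ} (hφ : ConvexOn ℝ univ φ) {s₁ s₂ : ℝ}
    (h₁ : 0 ≤ s₁) (h₂ : 0 ≤ s₂) :
    MonotoneOn (fun x => φ (upperEigenvalue s₁ s₂ x) + φ (lowerEigenvalue s₁ s₂ x)) (Ici 0) := by
  intro x hx y _ hxy
  refine hφ.symm_pair_mono (s₁ + s₂) (Real.sqrt_nonneg _) (Real.sqrt_le_sqrt ?_)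
  have : x ^ 2 ≤ y ^ 2 := pow_le_pow_left₀ hx hxy 2
  have h : 0 ≤ 4 * s₁ * s₂ := by positivity
  nlinarith [mul_le_mul_of_nonneg_left this h]

theorem convexOn_max_sub_zero (t : ℝ) : ConvexOn ℝ univ fun x : ℝ => max (x - t) 0 :=
  ((convexOn_id convex_univ).sub (concaveOn_const t convex_univ)).sup
    (convexOn_const 0 convex_univ)

/-- Split monic polynomials agreeing at every real point have the same multiset of roots. Spectra
can thus be compared through determinants. -/
theorem sum_eq_of_prod_sub_eq {ι κ : Type*} [Fintype ι] [Fintype κ] {x : ι → ℝ} {y : κ → ℝ}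
    (h : ∀ z : ℝ, ∏ i, (z - x i) = ∏ j, (z - y j)) (φ : ℝ → ℝ) :
    ∑ i, φ (x i) = ∑ j, φ (y j) := by
  open Polynomial in
  have hp : ∏ i, (X - C (x i)) = ∏ j, (X - C (y j)) := by
    refine Polynomial.funext fun z => ?_
    simpa [eval_prod] using h z
  have hm : Finset.univ.val.map x = Finset.univ.val.map y := by
    have := congrArg Polynomial.roots hp
    rw [← Polynomial.roots_multiset_prod_X_sub_C (Finset.univ.val.map x),
      ← Polynomial.roots_multiset_prod_X_sub_C (Finset.univ.val.map y), Multiset.map_map,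
      Multiset.map_map]
    exact this
  have := congrArg (fun s => (Multiset.map φ s).sum) hm
  simp only [Multiset.map_map] at this
  exact this

end SpinAlignment

namespace SpinAlignment

open Set

/-! ### Determinants and spectra -/

section

variable {K : Type*} [NormedAddCommGroup K] [InnerProductSpace ℂ K]

theorem _root_.LinearMap.det_eq_prod_of_apply_basis {ι R M : Type*} [Fintype ι] [DecidableEq ι]
    [CommRing R] [AddCommGroup M] [Module R M] (b : Module.Basis ι R M) {T : M →ₗ[R] M} {t : ι → R}
    (h : ∀ i, T (b i) = t i • b i) : LinearMap.det T = ∏ i, t i := by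
  have : LinearMap.toMatrix b b T = Matrix.diagonal t := by
    ext i j
    rw [LinearMap.toMatrix_apply, h, map_smul, Module.Basis.repr_self, Finsupp.smul_apply,
      Finsupp.single_apply, Matrix.diagonal_apply]
    by_cases hij : i = j
    · subst hij; simp
    · simp [hij, Ne.symm hij]
  rw [← LinearMap.det_toMatrix b, this, Matrix.det_diagonal]

theorem _root_.LinearMap.det_smul_one_sub_mul_comm {M : Type*} [AddCommGroup M] [Module ℂ M]
    [FiniteDimensional ℂ M] (w : ℂ) (A B : M →ₗ[ℂ] M) :
    LinearMap.det (w • 1 - A * B) = LinearMap.det (w • 1 - B * A) := by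
  let b := Module.finBasis ℂ M
  rw [← LinearMap.det_toMatrix b, ← LinearMap.det_toMatrix b]
  simp only [map_sub, map_smul, LinearMap.toMatrix_mul, LinearMap.toMatrix_one]
  have := congrArg (Polynomial.eval w)
    (Matrix.charpoly_mul_comm (LinearMap.toMatrix b b A) (LinearMap.toMatrix b b B))
  rw [Matrix.eval_charpoly, Matrix.eval_charpoly] at this
  simpa only [Matrix.scalar_apply, Matrix.smul_one_eq_diagonal] using this

/-- Since `(z - sP)P = (z - s)P` and `Q(z - tQ) = (z - t)Q`, the scalar `(z - s)(z - t)` factors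
out, and the `PQ` term of `(z - sP)(z - tQ)` cancels. -/
theorem smul_one_sub_mul_smul_one_sub {A : Type*} [Ring A] [Algebra ℂ A] {P Q : A}
    (hP : P * P = P) (hQ : Q * Q = Q) (s t z : ℂ) :
    (z • 1 - s • P) * ((((z - s) * (z - t)) • 1 - (s * t) • (P * Q)) * (z • 1 - t • Q)) =
      ((z - s) * (z - t) * z) • (z • 1 - (s • P + t • Q)) := by
  have hPQ : P * (P * Q) = P * Q := by rw [← mul_assoc, hP]
  simp only [sub_mul, mul_sub, smul_mul_assoc, mul_smul_comm, mul_one, one_mul, smul_sub,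
    smul_add, smul_smul, mul_assoc, hQ, hPQ]
  module

variable [FiniteDimensional ℂ K] [CompleteSpace K]

/-- An orthonormal eigenbasis for `eigenvalueVector S`. -/
noncomputable def eigenbasis (S : selfAdjoint (K →L[ℂ] K)) :
    OrthonormalBasis (Fin (Module.finrank ℂ K)) ℂ K :=
  (ContinuousLinearMap.isSelfAdjoint_iff_isSymmetric.mp S.2).eigenvectorBasis rfl

theorem apply_eigenbasis (S : selfAdjoint (K →L[ℂ] K)) (i : Fin (Module.finrank ℂ K)) :
    (S : K →L[ℂ] K) (eigenbasis S i) = (eigenvalueVector S i : ℂ) • eigenbasis S i :=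
  (ContinuousLinearMap.isSelfAdjoint_iff_isSymmetric.mp S.2).apply_eigenvectorBasis rfl i

theorem antitone_eigenvalueVector (S : selfAdjoint (K →L[ℂ] K)) : Antitone (eigenvalueVector S) :=
  (ContinuousLinearMap.isSelfAdjoint_iff_isSymmetric.mp S.2).eigenvalues_antitone rfl

theorem sum_eigenvalueVector (S : selfAdjoint (K →L[ℂ] K)) :
    ∑ i, eigenvalueVector S i = (LinearMap.trace ℂ K (S : K →L[ℂ] K)).re :=
  ((ContinuousLinearMap.isSelfAdjoint_iff_isSymmetric.mp S.2).re_trace_eq_sum_eigenvalues rfl).symm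

theorem det_smul_one_sub (S : selfAdjoint (K →L[ℂ] K)) (z s : ℝ) :
    LinearMap.det ((z : ℂ) • (1 : K →ₗ[ℂ] K) - (s : ℂ) • ((S : K →L[ℂ] K) : K →ₗ[ℂ] K)) =
      ((∏ i, (z - s * eigenvalueVector S i) : ℝ) : ℂ) := by
  rw [LinearMap.det_eq_prod_of_apply_basis (eigenbasis S).toBasis
    (t := fun i => ((z - s * eigenvalueVector S i : ℝ) : ℂ))]
  · push_cast; rfl
  · intro i
    simp only [OrthonormalBasis.coe_toBasis, LinearMap.sub_apply, LinearMap.smul_apply,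
      Module.End.one_apply, ContinuousLinearMap.coe_coe, apply_eigenbasis]
    push_cast
    module

theorem sum_eigenvalueVector_of_apply_basis (S : selfAdjoint (K →L[ℂ] K)) {ι : Type*} [Fintype ι]
    [DecidableEq ι] (b : Module.Basis ι ℂ K) {t : ι → ℝ}
    (h : ∀ i, (S : K →L[ℂ] K) (b i) = (t i : ℂ) • b i) (φ : ℝ → ℝ) :
    ∑ i, φ (eigenvalueVector S i) = ∑ i, φ (t i) := by
  refine sum_eq_of_prod_sub_eq (fun z => ?_) φ
  have h₁ := det_smul_one_sub S z 1
  rw [LinearMap.det_eq_prod_of_apply_basis b (t := fun i => ((z - t i : ℝ) : ℂ))] at h₁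
  · simp only [one_mul] at h₁
    exact_mod_cast h₁.symm
  · intro i
    simp only [LinearMap.sub_apply, LinearMap.smul_apply, Module.End.one_apply,
      ContinuousLinearMap.coe_coe, h]
    push_cast
    module

theorem le_of_sum_eq {d : ℕ} {x y : Fin d → ℝ} (hx : Antitone x) (hy : Antitone y)
    (h : ∀ φ : ℝ → ℝ, ∑ i, φ (x i) = ∑ i, φ (y i)) : x ≤ y := by
  intro i
  by_contra! hi
  -- This test function counts entries that are at least `x i`: at least `i + 1` for `x`, at most
  -- `i` for `y`.
  have hφ := h fun u => if x i ≤ u then 1 else 0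
  simp only [Finset.sum_boole, Nat.cast_inj] at hφ
  have h₁ : Finset.Iic i ⊆ Finset.univ.filter fun j => x i ≤ x j := fun j hj => by
    simpa using hx (Finset.mem_Iic.mp hj)
  have h₂ : (Finset.univ.filter fun j => x i ≤ y j) ⊆ Finset.Iio i := fun j hj => by
    rw [Finset.mem_Iio]
    by_contra! hij
    exact absurd ((Finset.mem_filter.mp hj).2.trans (hy hij)) hi.not_ge
  have h₁' := Finset.card_le_card h₁
  have h₂' := Finset.card_le_card h₂
  rw [Fin.card_Iic] at h₁'
  rw [Fin.card_Iio] at h₂'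
  omega

theorem eigenvalueVector_eq_of_sum_eq {S T : selfAdjoint (K →L[ℂ] K)}
    (h : ∀ φ : ℝ → ℝ, ∑ i, φ (eigenvalueVector S i) = ∑ i, φ (eigenvalueVector T i)) :
    eigenvalueVector S = eigenvalueVector T := by
  exact le_antisymm
    (le_of_sum_eq (antitone_eigenvalueVector S) (antitone_eigenvalueVector T) h)
    (le_of_sum_eq (antitone_eigenvalueVector T) (antitone_eigenvalueVector S) fun φ => (h φ).symm)

section Projection

variable {P : selfAdjoint (K →L[ℂ] K)} (hP : IsStarProjection P.1)

include hP in
theorem eigenvalueVector_eq_zero_or_one (i : Fin (Module.finrank ℂ K)) :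
    eigenvalueVector P i = 0 ∨ eigenvalueVector P i = 1 := by
  have h : P.1 (P.1 (eigenbasis P i)) =
      P.1 (eigenbasis P i) := by
    rw [← mul_apply_eq_comp, hP.isIdempotentElem.eq]
  rw [apply_eigenbasis, map_smul, apply_eigenbasis, smul_smul] at h
  have h' : (eigenvalueVector P i : ℂ) * eigenvalueVector P i = eigenvalueVector P i :=
    smul_left_injective ℂ ((eigenbasis P).toBasis.ne_zero i)
      (by simpa only [OrthonormalBasis.coe_toBasis] using h)
  have h'' : eigenvalueVector P i * eigenvalueVector P i = eigenvalueVector P i := by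
    exact_mod_cast h'
  rcases eq_or_ne (eigenvalueVector P i) 0 with h₀ | h₀
  · exact Or.inl h₀
  · exact Or.inr (mul_left_cancel₀ h₀ (by rw [h'', mul_one]))

include hP in
theorem sum_eigenvalueVector_eq_rank :
    ∑ i, eigenvalueVector P i = rank P.1 := by
  rw [sum_eigenvalueVector]
  have hid : IsIdempotentElem (P.1 : K →ₗ[ℂ] K) :=
    congrArg (fun T : K →L[ℂ] K => (T : K →ₗ[ℂ] K)) hP.isIdempotentElem.eq
  rw [(LinearMap.isProj_range_iff_isIdempotentElem _).mpr hid |>.trace]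
  simp [rank]

include hP in
theorem sum_smul_eigenvalueVector (s : ℝ) (φ : ℝ → ℝ) :
    ∑ i, φ (s * eigenvalueVector P i) =
      Module.finrank ℂ K * φ 0 + rank P.1 * (φ s - φ 0) := by
  have h : ∀ i, φ (s * eigenvalueVector P i) = φ 0 + eigenvalueVector P i * (φ s - φ 0) := by
    intro i
    rcases eigenvalueVector_eq_zero_or_one hP i with h | h <;> simp [h]
  simp_rw [h]
  rw [Finset.sum_add_distrib, ← Finset.sum_mul, sum_eigenvalueVector_eq_rank hP]
  simp

include hP in
theorem eigenvalueVector_eq_of_rank_eq {Q : selfAdjoint (K →L[ℂ] K)}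
    (hQ : IsStarProjection Q.1)
    (h : rank P.1 = rank Q.1) :
    eigenvalueVector P = eigenvalueVector Q := by
  refine eigenvalueVector_eq_of_sum_eq fun φ => ?_
  have h₁ := sum_smul_eigenvalueVector hP 1 φ
  have h₂ := sum_smul_eigenvalueVector hQ 1 φ
  simp only [one_mul] at h₁ h₂
  rw [h₁, h₂, h]

end Projection

/-- `|T|` as a self-adjoint operator. -/
noncomputable def absSelfAdjoint (T : K →L[ℂ] K) : selfAdjoint (K →L[ℂ] K) :=
  ⟨CFC.abs T, (CFC.abs_nonneg T).isSelfAdjoint⟩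

theorem sum_eigenvalueVector_absSelfAdjoint (T : K →L[ℂ] K) :
    ∑ i, eigenvalueVector (absSelfAdjoint T) i = traceAbs T :=
  sum_eigenvalueVector _

theorem eigenvalueVector_absSelfAdjoint_nonneg (T : K →L[ℂ] K) (i : Fin (Module.finrank ℂ K)) :
    0 ≤ eigenvalueVector (absSelfAdjoint T) i := by
  have h := (ContinuousLinearMap.nonneg_iff_isPositive _).mp (CFC.abs_nonneg T)
  exact LinearMap.IsPositive.nonneg_eigenvalues h.toLinearMap rfl i

theorem eigenvalueVector_absSelfAdjoint_le_norm (T : K →L[ℂ] K) (i : Fin (Module.finrank ℂ K)) :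
    eigenvalueVector (absSelfAdjoint T) i ≤ ‖T‖ := by
  have h := (CFC.abs T).le_opNorm (eigenbasis (absSelfAdjoint T) i)
  rw [show CFC.abs T (eigenbasis (absSelfAdjoint T) i) = _ from
    apply_eigenbasis (absSelfAdjoint T) i, norm_smul, OrthonormalBasis.norm_eq_one, mul_one, mul_one,
    CFC.norm_abs, Complex.norm_real] at h
  exact (le_abs_self _).trans h

/-! ### The spectrum of a combination of two projections -/

section Pair

variable {P Q : selfAdjoint (K →L[ℂ] K)} (hP : IsStarProjection P.1)
  (hQ : IsStarProjection Q.1)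

include hP hQ in
-- As `PQ = (PQ)Q`, cyclicity of the determinant replaces `PQ` by `Q(PQ) = |PQ|²`, which is diagonal
-- in an eigenbasis of `|PQ|`.
theorem det_smul_one_sub_mul_projections (w k : ℝ) :
    LinearMap.det ((w : ℂ) • (1 : K →ₗ[ℂ] K) - (k : ℂ) •
      ((P.1 : K →ₗ[ℂ] K) * (Q.1 : K →ₗ[ℂ] K))) =
    ((∏ i, (w - k * eigenvalueVector (absSelfAdjoint (P.1 * Q.1)) i ^ 2 : ℝ) : ℝ) : ℂ) := by
  set D := absSelfAdjoint (P.1 * Q.1)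
  have hsq : D.1 * D.1 = Q.1 * (P.1 * Q.1) := by
    have : D.1 * D.1 = _ := CFC.abs_mul_abs (P.1 * Q.1)
    rw [this, star_mul, hP.isSelfAdjoint.star_eq, hQ.isSelfAdjoint.star_eq, mul_assoc,
      ← mul_assoc P.1 P.1,
      hP.isIdempotentElem.eq]
  have hPQ : P.1 * Q.1 = (P.1 * Q.1) * Q.1 := by
    rw [mul_assoc, hQ.isIdempotentElem.eq]
  have hcomm : LinearMap.det ((w : ℂ) • (1 : K →ₗ[ℂ] K) - (k : ℂ) •
      ((P.1 : K →ₗ[ℂ] K) * (Q.1 : K →ₗ[ℂ] K))) =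
      LinearMap.det ((w : ℂ) • (1 : K →ₗ[ℂ] K) - (k : ℂ) •
        (D.1 * D.1 : K →L[ℂ] K).toLinearMap) := by
    have e₁ : (P.1 : K →ₗ[ℂ] K) * (Q.1 : K →ₗ[ℂ] K) =
      ((P.1 * Q.1 : K →L[ℂ] K) : K →ₗ[ℂ] K) * (Q.1 : K →ₗ[ℂ] K) :=
      congrArg ContinuousLinearMap.toLinearMap hPQ
    rw [e₁, ← smul_mul_assoc, LinearMap.det_smul_one_sub_mul_comm, mul_smul_comm, hsq]
    rfl
  rw [hcomm, LinearMap.det_eq_prod_of_apply_basis (eigenbasis D).toBasis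
    (t := fun i => ((w - k * eigenvalueVector D i ^ 2 : ℝ) : ℂ))]
  · push_cast; rfl
  · intro i
    simp only [OrthonormalBasis.coe_toBasis, LinearMap.sub_apply, LinearMap.smul_apply,
      Module.End.one_apply, ContinuousLinearMap.coe_coe, mul_apply_eq_comp,
      apply_eigenbasis, map_smul]
    push_cast
    module

include hP hQ in
/-- The spectrum of `s₁ P + s₂ Q` in terms of the singular values of `P Q`, tested against an
arbitrary function `φ`. -/
theorem sum_eigenvalueVector_smul_add_smul {s₁ s₂ : ℝ} (h₁ : 0 ≤ s₁) (h₂ : 0 ≤ s₂) (φ : ℝ → ℝ) :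
    ∑ i, φ (eigenvalueVector (s₁ • P + s₂ • Q) i) +
        Module.finrank ℂ K * (φ s₁ + φ s₂ + φ 0) =
      ∑ i, φ (s₁ * eigenvalueVector P i) + ∑ i, φ (s₂ * eigenvalueVector Q i) +
        ∑ i, (φ (upperEigenvalue s₁ s₂ (eigenvalueVector (absSelfAdjoint (P.1 * Q.1)) i)) +
          φ (lowerEigenvalue s₁ s₂
            (eigenvalueVector (absSelfAdjoint (P.1 * Q.1)) i))) := by
  set d := Module.finrank ℂ K
  set σ := eigenvalueVector (absSelfAdjoint (P.1 * Q.1))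
  -- Both multisets have `4d` elements; the `d` copies each of `s₁`, `s₂`, `0` are the roots of the
  -- scalar factor `((z - s₁)(z - s₂)z)^d`.
  have key := sum_eq_of_prod_sub_eq
    (x := Sum.elim (eigenvalueVector (s₁ • P + s₂ • Q)) (Sum.elim (fun _ : Fin d => s₁)
      (Sum.elim (fun _ : Fin d => s₂) (fun _ : Fin d => 0))))
    (y := Sum.elim (fun i => s₁ * eigenvalueVector P i) (Sum.elim
      (fun i => s₂ * eigenvalueVector Q i) (Sum.elim (fun i => upperEigenvalue s₁ s₂ (σ i))
        (fun i => lowerEigenvalue s₁ s₂ (σ i))))) ?_ φ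
  · simp only [Fintype.sum_sum_type, Sum.elim_inl, Sum.elim_inr, Finset.sum_const,
      Finset.card_univ, Fintype.card_fin, nsmul_eq_mul] at key
    rw [Finset.sum_add_distrib]
    linarith
  · intro z
    simp only [Fintype.prod_sum_type, Sum.elim_inl, Sum.elim_inr, Finset.prod_const,
      Finset.card_univ, Fintype.card_fin, sub_zero]
    rw [← Finset.prod_mul_distrib]
    simp_rw [sub_upperEigenvalue_mul_sub_lowerEigenvalue h₁ h₂]
    have hPP : (P.1 : K →ₗ[ℂ] K) * (P.1 : K →ₗ[ℂ] K) = P.1 :=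
      congrArg ContinuousLinearMap.toLinearMap hP.isIdempotentElem.eq
    have hQQ : (Q.1 : K →ₗ[ℂ] K) * (Q.1 : K →ₗ[ℂ] K) = Q.1 :=
      congrArg ContinuousLinearMap.toLinearMap hQ.isIdempotentElem.eq
    have hdet := congrArg LinearMap.det (smul_one_sub_mul_smul_one_sub hPP hQQ (s₁ : ℂ) s₂ z)
    have hsum : (s₁ : ℂ) • (P.1 : K →ₗ[ℂ] K) + (s₂ : ℂ) • (Q.1 : K →ₗ[ℂ] K) =
        (1 : ℝ) • (((s₁ • P + s₂ • Q : selfAdjoint (K →L[ℂ] K)) : K →L[ℂ] K) : K →ₗ[ℂ] K) := by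
      ext v
      simp
    rw [hsum, LinearMap.det_smul, map_mul, map_mul, det_smul_one_sub] at hdet
    have e := det_smul_one_sub_mul_projections hP hQ ((z - s₁) * (z - s₂)) (s₁ * s₂)
    push_cast at e
    rw [e, det_smul_one_sub, ← Complex.coe_smul (1 : ℝ), det_smul_one_sub] at hdet
    simp only [one_mul] at hdet
    have hreal : ((z - s₁) * (z - s₂) * z) ^ d * ∏ i, (z - eigenvalueVector (s₁ • P + s₂ • Q) i) =
      (∏ i, (z - s₁ * eigenvalueVector P i)) * ((∏ i, ((z - s₁) * (z - s₂) - s₁ * s₂ * σ i ^ 2)) *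
        ∏ i, (z - s₂ * eigenvalueVector Q i)) := by
      exact_mod_cast hdet.symm
    rw [mul_pow, mul_pow] at hreal
    linear_combination hreal

end Pair

end

end SpinAlignment

namespace SpinAlignment

open Set

section

variable {K : Type*} [NormedAddCommGroup K] [InnerProductSpace ℂ K] [FiniteDimensional ℂ K]
  [CompleteSpace K]

theorem sum_eigenvalueVector_absSelfAdjoint_of_apply_basis (T : K →L[ℂ] K) {ι : Type*} [Fintype ι]
    [DecidableEq ι] (b : Module.Basis ι ℂ K) {t : ι → ℝ} (ht : ∀ i, 0 ≤ t i)
    (h : ∀ i, (star T * T) (b i) = ((t i ^ 2 : ℝ) : ℂ) • b i) (φ : ℝ → ℝ) :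
    ∑ i, φ (eigenvalueVector (absSelfAdjoint T) i) = ∑ i, φ (t i) := by
  let S : selfAdjoint (K →L[ℂ] K) := ⟨star T * T, IsSelfAdjoint.star_mul_self T⟩
  have hS : ∀ i, S.1 ((eigenbasis (absSelfAdjoint T)).toBasis i) =
      ((eigenvalueVector (absSelfAdjoint T) i ^ 2 : ℝ) : ℂ) •
        (eigenbasis (absSelfAdjoint T)).toBasis i := by
    intro i
    have hsq : S.1 = (absSelfAdjoint T).1 * (absSelfAdjoint T).1 := (CFC.abs_mul_abs T).symm
    rw [hsq, OrthonormalBasis.coe_toBasis, mul_apply_eq_comp, apply_eigenbasis, map_smul,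
      apply_eigenbasis, smul_smul]
    push_cast
    rw [sq]
  -- Both bases diagonalize `T⋆T`; testing with `φ ∘ √` recovers the singular values.
  have h₁ := sum_eigenvalueVector_of_apply_basis S _ hS fun u => φ √u
  have h₂ := sum_eigenvalueVector_of_apply_basis S b h fun u => φ √u
  simp only [Real.sqrt_sq (eigenvalueVector_absSelfAdjoint_nonneg T _)] at h₁
  simp only [Real.sqrt_sq (ht _)] at h₂
  rw [← h₁, h₂]

/-! ### Comparison with an arbitrary pair -/

section Compare

variable {P Q R R' : selfAdjoint (K →L[ℂ] K)}

theorem eigenvalueVector_absSelfAdjoint_mul_le_one (hR : IsStarProjection R.1)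
    (hR' : IsStarProjection R'.1) (i : Fin (Module.finrank ℂ K)) :
    eigenvalueVector (absSelfAdjoint (R.1 * R'.1)) i ≤ 1 :=
  (eigenvalueVector_absSelfAdjoint_le_norm _ i).trans <| (norm_mul_le _ _).trans <|
    mul_le_one₀ hR.norm_le (norm_nonneg _) hR'.norm_le

theorem majorizes_of_greedy_singular_values {c s₁ s₂ : ℝ}
    (hP : IsStarProjection P.1) (hQ : IsStarProjection Q.1)
    (hR : IsStarProjection R.1) (hR' : IsStarProjection R'.1)
    (hrank : rank R.1 = rank P.1) (hrank' : rank R'.1 = rank Q.1)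
    (hgreedy : ∀ φ : ℝ → ℝ, ∑ i, φ (eigenvalueVector (absSelfAdjoint (P.1 * Q.1)) i) =
      ∑ i : Fin (Module.finrank ℂ K), φ (unitClamp (c - i)))
    (hc : traceAbs (R.1 * R'.1) ≤ c) (h₁ : 0 ≤ s₁) (h₂ : 0 ≤ s₂) :
    Majorizes (s₁ • P + s₂ • Q) (s₁ • R + s₂ • R') := by
  have hPQ := sum_eigenvalueVector_smul_add_smul hP hQ h₁ h₂
  have hRR := sum_eigenvalueVector_smul_add_smul hR hR' h₁ h₂
  simp only [sum_smul_eigenvalueVector hP, sum_smul_eigenvalueVector hQ] at hPQ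
  simp only [sum_smul_eigenvalueVector hR, sum_smul_eigenvalueVector hR', hrank, hrank'] at hRR
  refine vecMajorizes_of_sum_max ?_ fun t => ?_
  -- The trace does not see the singular values: each pair of eigenvalues sums to `s₁ + s₂`.
  · have e₁ := hPQ fun u => u
    have e₂ := hRR fun u => u
    simp only [upperEigenvalue_add_lowerEigenvalue] at e₁ e₂
    linarith
  · have e₁ := hPQ fun u => max (u - t) 0
    have e₂ := hRR fun u => max (u - t) 0
    have hle := sum_le_sum_unitClamp
      (convexOn_pair_eigenvalues (convexOn_max_sub_zero t) h₁ h₂)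
      (monotoneOn_pair_eigenvalues (convexOn_max_sub_zero t) h₁ h₂)
      (eigenvalueVector_absSelfAdjoint_nonneg (R.1 * R'.1))
      (eigenvalueVector_absSelfAdjoint_mul_le_one hR hR')
      ((sum_eigenvalueVector_absSelfAdjoint _).trans_le hc)
    rw [← hgreedy fun x => max (upperEigenvalue s₁ s₂ x - t) 0 +
      max (lowerEigenvalue s₁ s₂ x - t) 0] at hle
    linarith

end Compare

/-! ### Construction of the optimal pair -/

theorem exists_projection_of_orthonormal {m : ℕ} {w : Fin m → K} (hw : Orthonormal ℂ w) :
    ∃ P : selfAdjoint (K →L[ℂ] K), IsStarProjection P.1 ∧ rank P.1 = m ∧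
      ∀ x, P.1 x = ∑ k, inner ℂ (w k) x • w k := by
  have hp : IsStarProjection (Submodule.span ℂ (range w)).starProjection :=
    isStarProjection_starProjection
  refine ⟨⟨(Submodule.span ℂ (range w)).starProjection, hp.isSelfAdjoint⟩, hp, ?_, fun x => ?_⟩
  · have hr : LinearMap.range (Submodule.span ℂ (range w)).starProjection.toLinearMap =
        Submodule.span ℂ (range w) := Submodule.range_starProjection _
    rw [rank, hr, finrank_span_eq_card hw.linearIndependent, Fintype.card_fin]
  · have hmem : ∑ k, inner ℂ (w k) x • w k ∈ Submodule.span ℂ (range w) :=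
      Submodule.sum_mem _ fun k _ =>
        Submodule.smul_mem _ _ (Submodule.subset_span (mem_range_self k))
    refine Submodule.eq_starProjection_of_mem_of_inner_eq_zero hmem ?_
    intro y hy
    induction hy using Submodule.span_induction with
    | mem y hy =>
      obtain ⟨j, rfl⟩ := hy
      rw [inner_sub_left, sum_inner, Finset.sum_eq_single j]
      · rw [inner_smul_left, inner_conj_symm, orthonormal_iff_ite.mp hw, if_pos rfl, mul_one,
          sub_self]
      · intro k _ hk
        rw [inner_smul_left, orthonormal_iff_ite.mp hw, if_neg hk, mul_zero]
      · exact fun h => absurd (Finset.mem_univ j) h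
    | zero => exact inner_zero_right _
    | add y z _ _ hy hz => rw [inner_add_right, hy, hz, add_zero]
    | smul a y _ hy => rw [inner_smul_right, hy, mul_zero]

omit [FiniteDimensional ℂ K] [CompleteSpace K] in
-- The conditions on `f` are imposed only where coefficients are nonzero, so `f` may take junk
-- values wherever `ρ` vanishes.
theorem orthonormal_rotated {ι κ : Type*} [DecidableEq ι] [DecidableEq κ] {b : κ → K}
    (hb : Orthonormal ℂ b)
    {p f : ι → κ} {τ ρ : ι → ℝ} (hτρ : ∀ i, τ i ^ 2 + ρ i ^ 2 = 1) (hp : p.Injective)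
    (hpf : ∀ i j, τ i ≠ 0 → ρ j ≠ 0 → p i ≠ f j)
    (hf : ∀ i j, ρ i ≠ 0 → ρ j ≠ 0 → f i = f j → i = j) :
    Orthonormal ℂ fun i => (τ i : ℂ) • b (p i) + (ρ i : ℂ) • b (f i) := by
  rw [orthonormal_iff_ite] at hb ⊢
  have hcross : ∀ i j, (τ i : ℂ) * ((ρ j : ℂ) * (if p i = f j then 1 else 0)) = 0 := by
    intro i j
    by_cases h₁ : τ i = 0
    · simp [h₁]
    by_cases h₂ : ρ j = 0
    · simp [h₂]
    simp [hpf i j h₁ h₂]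
  intro i j
  simp only [inner_add_left, inner_add_right, inner_smul_left, inner_smul_right, hb,
    Complex.conj_ofReal]
  have h₁ := hcross i j
  have h₂ := hcross j i
  simp only [eq_comm (a := p j)] at h₂
  rcases eq_or_ne i j with rfl | hij
  · have := congrArg (fun u : ℝ => (u : ℂ)) (hτρ i)
    push_cast at this
    simp only [if_true]
    linear_combination this + h₁ + h₂
  · have h₃ : (ρ i : ℂ) * ((ρ j : ℂ) * (if f i = f j then 1 else 0)) = 0 := by
      by_cases h₁ : ρ i = 0
      · simp [h₁]
      by_cases h₂ : ρ j = 0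
      · simp [h₂]
      have : f i ≠ f j := fun h => hij (hf i j h₁ h₂ h)
      simp [this]
    rw [if_neg hij, if_neg (hp.ne hij)]
    linear_combination h₁ + h₂ + h₃

/-- `Q` projects onto the span of the first `r₂` basis vectors, and `P` onto that of vectors `w j`
obtained by tilting `b j` out of the range of `Q` with cosine `τ j`. Then `QPQ` is diagonal with
entries `τ j ^ 2`. -/
theorem exists_greedy_projections (r₁ r₂ : ℕ) (c : ℝ)
    (hr₁ : r₁ ≤ Module.finrank ℂ K) (hr₂ : r₂ ≤ Module.finrank ℂ K) (hc₀ : 0 ≤ c)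
    (hfeas : r₁ + r₂ ≤ Module.finrank ℂ K + ⌊c⌋₊) (hc₁ : c ≤ r₁) (hc₂ : c ≤ r₂) :
    ∃ P Q : selfAdjoint (K →L[ℂ] K), IsStarProjection P.1 ∧ IsStarProjection Q.1 ∧
      rank P.1 = r₁ ∧ rank Q.1 = r₂ ∧
      (∀ φ : ℝ → ℝ, ∑ i, φ (eigenvalueVector (absSelfAdjoint (P.1 * Q.1)) i) =
        ∑ i : Fin (Module.finrank ℂ K), φ (unitClamp (c - i))) ∧
      ((∃ n : ℕ, c = n) → Commute P.1 Q.1) := by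
  set d := Module.finrank ℂ K
  set n := ⌊c⌋₊
  let b : OrthonormalBasis (Fin d) ℂ K := stdOrthonormalBasis ℂ K
  let τ : ℕ → ℝ := fun j => unitClamp (c - j)
  let ρ : ℕ → ℝ := fun j => √(1 - τ j ^ 2)
  let p : Fin r₁ → Fin d := Fin.castLE hr₁
  -- Only indices `j ≥ n` need a direction outside the range of `Q`; `hfeas` leaves room for these
  -- `r₁ - n` directions. The default `p j` occurs only where `ρ j = 0`.
  let f : Fin r₁ → Fin d := fun j => if h : r₂ + (j - n) < d then ⟨r₂ + (j - n), h⟩ else p j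
  have hτ₀ : ∀ j, 0 ≤ τ j := fun j => unitClamp_nonneg _
  have hτ₁ : ∀ j, τ j ^ 2 ≤ 1 := fun j => pow_le_one₀ (hτ₀ j) (unitClamp_le_one _)
  have hτρ : ∀ j, τ j ^ 2 + ρ j ^ 2 = 1 := fun j => by
    rw [Real.sq_sqrt (sub_nonneg.mpr (hτ₁ j))]
    ring
  have hτlt : ∀ j r : ℕ, c ≤ r → τ j ≠ 0 → j < r := by
    intro j r hr hj
    by_contra! h
    have : (r : ℝ) ≤ j := by exact_mod_cast h
    exact hj (unitClamp_of_nonpos (by linarith))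
  have hρn : ∀ j, ρ j ≠ 0 → n ≤ j := by
    intro j hj
    by_contra! h
    have h₁ : ((j + 1 : ℕ) : ℝ) ≤ c := (Nat.le_floor_iff hc₀).mp h
    push_cast at h₁
    exact hj (by simp only [ρ, τ]; rw [unitClamp_of_one_le (by linarith)]; simp)
  have hfval : ∀ j : Fin r₁, ρ j ≠ 0 → (f j : ℕ) = r₂ + (j - n) := by
    intro j hj
    have h₁ := hρn j hj
    have h₂ := j.isLt
    have h : r₂ + ((j : ℕ) - n) < d := by omega
    simp only [f, dif_pos h]
  have hbb := orthonormal_iff_ite.mp b.orthonormal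
  let w : Fin r₁ → K := fun j => (τ j : ℂ) • b (p j) + (ρ j : ℂ) • b (f j)
  have hw : Orthonormal ℂ w := by
    refine orthonormal_rotated b.orthonormal (fun i => hτρ i) (Fin.castLE_injective hr₁) ?_ ?_
    · intro i j hi hj h
      have h₁ := congrArg Fin.val h
      rw [hfval j hj] at h₁
      have h₂ := hτlt i r₂ hc₂ hi
      simp only [p, Fin.val_castLE] at h₁
      omega
    · intro i j hi hj h
      have h₁ := congrArg Fin.val h
      rw [hfval i hi, hfval j hj] at h₁
      have h₂ := hρn i hi
      have h₃ := hρn j hj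
      exact Fin.ext (by omega)
  obtain ⟨P, hP, hPr, hPw⟩ := exists_projection_of_orthonormal hw
  obtain ⟨Q, hQ, hQr, hQw⟩ := exists_projection_of_orthonormal
    (b.orthonormal.comp (Fin.castLE hr₂) (Fin.castLE_injective hr₂))
  have hQb : ∀ j : Fin d, Q.1 (b j) = if (j : ℕ) < r₂ then b j else 0 := by
    intro j
    rw [hQw]
    simp only [Function.comp_apply, hbb, ite_smul, one_smul, zero_smul]
    split_ifs with hj
    · rw [Finset.sum_eq_single ⟨j, hj⟩]
      · simp
      · intro k _ hk
        rw [if_neg fun h => hk (Fin.ext (by simpa using congrArg Fin.val h))]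
      · exact fun h => absurd (Finset.mem_univ _) h
    · refine Finset.sum_eq_zero fun k _ => if_neg fun h => hj ?_
      rw [← h]
      exact k.isLt
  have hPb : ∀ j : Fin d, (j : ℕ) < r₂ → P.1 (b j) =
      if h : (j : ℕ) < r₁ then (τ j : ℂ) • w ⟨j, h⟩ else 0 := by
    intro j hj
    have hin : ∀ k : Fin r₁, inner ℂ (w k) (b j) = if p k = j then (τ k : ℂ) else 0 := by
      intro k
      have h₀ : (ρ k : ℂ) * (if f k = j then 1 else 0) = 0 := by
        by_cases h₁ : ρ k = 0
        · simp [h₁]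
        · rw [if_neg, mul_zero]
          intro h
          have := hfval k h₁
          rw [h] at this
          omega
      simp only [w, inner_add_left, inner_smul_left, hbb, Complex.conj_ofReal]
      rw [h₀, add_zero, mul_ite, mul_one, mul_zero]
    rw [hPw]
    simp only [hin]
    split_ifs with h
    · rw [Finset.sum_eq_single ⟨j, h⟩]
      · simp [p]
      · intro k _ hk
        rw [if_neg fun h => hk (Fin.ext (by simpa [p] using congrArg Fin.val h)), zero_smul]
      · exact fun h => absurd (Finset.mem_univ _) h
    · refine Finset.sum_eq_zero fun k _ => ?_
      rw [if_neg, zero_smul]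
      intro h'
      apply h
      rw [← h']
      exact k.isLt
  have hQwk : ∀ k : Fin r₁, Q.1 (w k) = (τ k : ℂ) • b (p k) := by
    intro k
    have e₁ : (τ k : ℂ) • Q.1 (b (p k)) = (τ k : ℂ) • b (p k) := by
      by_cases h : τ k = 0
      · simp [h]
      · rw [hQb, if_pos (show (p k : ℕ) < r₂ from hτlt k r₂ hc₂ h)]
    have e₂ : (ρ k : ℂ) • Q.1 (b (f k)) = 0 := by
      by_cases h : ρ k = 0
      · simp [h]
      · rw [hQb, if_neg (by rw [hfval k h]; omega), smul_zero]
    simp only [w, map_add, map_smul]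
    rw [e₁, e₂, add_zero]
  have hPQb : ∀ j : Fin d, P.1 (Q.1 (b j)) =
      if h : (j : ℕ) < r₁ then (τ j : ℂ) • w ⟨j, h⟩ else 0 := by
    intro j
    by_cases hj : (j : ℕ) < r₂
    · rw [hQb, if_pos hj, hPb j hj]
    · have : τ j = 0 := by
        by_contra h
        exact hj (hτlt j r₂ hc₂ h)
      rw [hQb, if_neg hj, map_zero, this]
      simp
  have hQPQ : ∀ j : Fin d, Q.1 (P.1 (Q.1 (b j))) = ((τ j ^ 2 : ℝ) : ℂ) • b j := by
    intro j
    rw [hPQb]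
    split_ifs with h
    · rw [map_smul, hQwk, smul_smul]
      push_cast
      rw [sq]
      rfl
    · have : τ j = 0 := by
        by_contra h'
        exact h (hτlt j r₁ hc₁ h')
      simp [this]
  have hstar : star (P.1 * Q.1) * (P.1 * Q.1) = Q.1 * (P.1 * Q.1) := by
    rw [star_mul, hP.isSelfAdjoint.star_eq, hQ.isSelfAdjoint.star_eq, mul_assoc,
      ← mul_assoc P.1 P.1, hP.isIdempotentElem.eq]
  refine ⟨P, Q, hP, hQ, hPr, hQr, fun φ => ?_, ?_⟩
  · refine sum_eigenvalueVector_absSelfAdjoint_of_apply_basis _ b.toBasis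
      (t := fun j => τ j) (fun j => hτ₀ j) (fun j => ?_) φ
    rw [hstar, OrthonormalBasis.coe_toBasis]
    exact hQPQ j
  · rintro ⟨m, hm⟩
    have h01 : ∀ j, τ j = 0 ∨ τ j = 1 := by
      intro j
      rcases le_or_gt m j with h | h
      · left
        have : (m : ℝ) ≤ j := by exact_mod_cast h
        exact unitClamp_of_nonpos (by linarith)
      · right
        have : ((j + 1 : ℕ) : ℝ) ≤ m := by exact_mod_cast h
        push_cast at this
        exact unitClamp_of_one_le (by linarith)
    -- For integer `c` each `τ j` is `0` or `1`, so `PQ` maps `b j` to `0` or to `b j`. Hence `PQ =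
    -- QPQ`, which is self-adjoint, and taking adjoints gives commutation.
    have hPQ : P.1 * Q.1 = Q.1 * (P.1 * Q.1) := by
      refine ContinuousLinearMap.coe_injective (b.toBasis.ext fun j => ?_)
      rw [OrthonormalBasis.coe_toBasis]
      change P.1 (Q.1 (b j)) = Q.1 (P.1 (Q.1 (b j)))
      rw [hQPQ, hPQb]
      rcases h01 j with h | h
      · simp [h]
      · have hj := hτlt j r₁ hc₁ (by rw [h]; exact one_ne_zero)
        have hρ : ρ j = 0 := by simp [ρ, h]
        rw [dif_pos hj]
        simp [w, h, hρ, p]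
    have hstar' := congrArg star hPQ
    rw [star_mul, star_mul, star_mul, hP.isSelfAdjoint.star_eq, hQ.isSelfAdjoint.star_eq,
      mul_assoc, ← hPQ] at hstar'
    exact hstar'.symm

end

end SpinAlignment

theorem mainTheorem3 {K : Type*} [NormedAddCommGroup K] [InnerProductSpace ℂ K]
    [FiniteDimensional ℂ K] [CompleteSpace K] (r₁ r₂ : ℕ) (c : ℝ)
    (hr₁ : r₁ ≤ Module.finrank ℂ K) (hr₂ : r₂ ≤ Module.finrank ℂ K) (hc₀ : 0 ≤ c)
    (hfeas : (r₁ : ℤ) + (r₂ : ℤ) - (Module.finrank ℂ K : ℤ) ≤ ⌊c⌋)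
    (hc : c ≤ min (r₁ : ℝ) (r₂ : ℝ)) :
    ∃ P ∈ SpinAlignment.projectorPairs K r₁ r₂ c,
      (∀ R ∈ SpinAlignment.projectorPairs K r₁ r₂ c,
        SpinAlignment.MoreAligned ![P.1, P.2] ![R.1, R.2]) ∧
      (∀ R ∈ SpinAlignment.projectorPairs K r₁ r₂ c, ∀ s₁ s₂ : ℝ, 0 ≤ s₁ → 0 ≤ s₂ →
        SpinAlignment.Majorizes (s₁ • P.1 + s₂ • P.2) (s₁ • R.1 + s₂ • R.2)) ∧
      SpinAlignment.traceAbs ((P.1 : K →L[ℂ] K) * (P.2 : K →L[ℂ] K)) = c ∧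
      ((∃ n : ℕ, c = (n : ℝ)) → Commute (P.1 : K →L[ℂ] K) (P.2 : K →L[ℂ] K)) := by
  open SpinAlignment in
  have hc₁ : c ≤ r₁ := hc.trans (min_le_left _ _)
  have hc₂ : c ≤ r₂ := hc.trans (min_le_right _ _)
  have hfeas' : r₁ + r₂ ≤ Module.finrank ℂ K + ⌊c⌋₊ := by
    have : (⌊c⌋₊ : ℤ) = ⌊c⌋ := Int.natCast_floor_eq_floor hc₀
    omega
  obtain ⟨P, Q, hP, hQ, hPr, hQr, hgreedy, hcomm⟩ :=
    exists_greedy_projections (K := K) r₁ r₂ c hr₁ hr₂ hc₀ hfeas' hc₁ hc₂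
  have htr : traceAbs (P.1 * Q.1) = c := by
    rw [← sum_eigenvalueVector_absSelfAdjoint, hgreedy fun u => u]
    -- `c ≤ d` ensures that the greedy vector fits into `d` slots without losing mass.
    exact sum_unitClamp hc₀ (hc₁.trans (by exact_mod_cast hr₁))
  have hmaj : ∀ R ∈ projectorPairs K r₁ r₂ c, ∀ s₁ s₂ : ℝ, 0 ≤ s₁ → 0 ≤ s₂ →
      Majorizes (s₁ • P + s₂ • Q) (s₁ • R.1 + s₂ • R.2) := by
    rintro R ⟨hR₁, hR₂, hrk₁, hrk₂, htrR⟩ s₁ s₂ h₁ h₂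
    exact majorizes_of_greedy_singular_values hP hQ hR₁ hR₂ (hrk₁.trans hPr.symm)
      (hrk₂.trans hQr.symm) hgreedy htrR h₁ h₂
  refine ⟨(P, Q), ⟨hP, hQ, hPr, hQr, htr.le⟩, fun R hR => ⟨fun i => ?_, fun p hp _ => ?_⟩, hmaj,
    htr, hcomm⟩
  · obtain ⟨hR₁, hR₂, hrk₁, hrk₂, -⟩ := hR
    fin_cases i
    · exact eigenvalueVector_eq_of_rank_eq hP hR₁ (hPr.trans hrk₁.symm)
    · exact eigenvalueVector_eq_of_rank_eq hQ hR₂ (hQr.trans hrk₂.symm)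
  · simpa [Fin.sum_univ_two] using hmaj R hR (p 0) (p 1) (hp 0) (hp 1)
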